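/- **Definitions.** A finite abstract simplicial complex $G$ is a finite set of non-empty finite sets (simplices) closed under taking non-empty subsets. For $x\in G$ let $U(x)=\{y\in G: x\subseteq y\}$ be its star, $B(x)=\{z\in G: z\subseteq y \text{ for some } y\in U(x)\}$ the unit ball, and $S(x)=B(x)\setminus U(x)$ the unit sphere; $S(x)$ and $G\setminus U(x)$ are again complexes. Inductively, a complex is *contractible* if it is the one-point complex, or if there is $x\in G$ such that both $S(x)$ and $G\setminus U(x)$ are contractible. The empty complex is the $(-1)$-sphere. A complex $G$ is a *$d$-manifold* if $S(x)$ is a $(d-1)$-sphere for every $x\in G$ (so the empty complex is a $d$-manifold), and for $d\ge 0$ a $d$-manifold $G$ is a *$d$-sphere* if $G\setminus U(x)$ is contractible for some $x\in G$. The *Whitney complex* of a graph consists of the non-empty finite sets of pairwise adjacent nodes. The *Barycentric refinement* $G_1$ of $G$ is the Whitney complex of the graph whose nodes are the simplices of $G$, two different ones being adjacent if one is contained in the other. Let $V$ be the set of vertices ($0$-dimensional simplices) of $G$ and $R$ a linearly ordered ring (such as $\mathbb{Z}$ or $\mathbb{R}$). A function $f:V\to R$ is *locally injective* if $f(v)\ne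 f(w)$ for all $v\in V$ and $w\in S(v)\cap V$. For $c\in R$, the *level set* $\{f=c\}$ is the Whitney complex of the graph whose nodes are the simplices of $G$ on which $f-c$ changes sign (takes both a negative and a positive value on vertices), two different ones being adjacent if one is contained in the other. **Theorem (Discrete Sard).** Let $G$ be a finite abstract simplicial complex that is a $d$-manifold and let $f:V\to R$ be locally injective. Then for every $c\in R$ with $c\notin f(V)$, the level set $\{f=c\}$ is a subcomplex of $G_1$ and is a $(d-1)$-manifold. -/

import Mathlib

namespace DiscreteSard

/-! Finite abstract simplicial complexes are modelled by Mathlib's `PreAbstractSimplicialComplex α`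
(a set of nonempty finite sets closed under taking nonempty subsets); finiteness is a hypothesis of
the theorem. The subcomplexes below are ordered by inclusion of their sets of simplices. -/

section Complexes

variable {α : Type*}

/-- The star `U(x) = {y ∈ G | x ⊆ y}`. -/
def openStar (G : PreAbstractSimplicialComplex α) (x : Finset α) : Set (Finset α) :=
  {y | y ∈ G.faces ∧ x ⊆ y}

/-- The unit ball `B(x)`: the closure of `U(x)`, i.e. all simplices of `G` that are contained in
some simplex of `U(x)`. (The stars are a basis of the topology, so a simplex `z` is in the closure
of a set `A` of simplices iff `U(z)` meets `A`.) -/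
def unitBall (G : PreAbstractSimplicialComplex α) (x : Finset α) : Set (Finset α) :=
  {z | z ∈ G.faces ∧ ∃ y ∈ openStar G x, z ⊆ y}

/-- The unit sphere `S(x) = B(x) \ U(x)`, which is again a simplicial complex. -/
def unitSphere (G : PreAbstractSimplicialComplex α) (x : Finset α) :
    PreAbstractSimplicialComplex α where
  faces := unitBall G x \ openStar G x
  isRelLowerSet_faces := by
    rintro z ⟨⟨hz, y, hy, hzy⟩, hzx⟩
    refine ⟨(G.isRelLowerSet_faces hz).1, fun t ht hne => ?_⟩
    have htG : t ∈ G.faces := (G.isRelLowerSet_faces hz).2 ht hne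
    exact ⟨⟨htG, y, hy, ht.trans hzy⟩, fun h => hzx ⟨hz, h.2.trans ht⟩⟩

/-- The complex `G \ U(x)`. -/
def deleteStar (G : PreAbstractSimplicialComplex α) (x : Finset α) :
    PreAbstractSimplicialComplex α where
  faces := G.faces \ openStar G x
  isRelLowerSet_faces := by
    rintro z ⟨hz, hzx⟩
    refine ⟨(G.isRelLowerSet_faces hz).1, fun t ht hne => ?_⟩
    exact ⟨(G.isRelLowerSet_faces hz).2 ht hne, fun h => hzx ⟨hz, h.2.trans ht⟩⟩

/-- Contractible complexes: a one point complex is contractible, and `G` is contractible if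
for some simplex `x` of `G` both `S(x)` and `G \ U(x)` are contractible. -/
inductive IsContractible : PreAbstractSimplicialComplex α → Prop
  | point (G : PreAbstractSimplicialComplex α) (v : α) (hG : G.faces = {{v}}) : IsContractible G
  | step (G : PreAbstractSimplicialComplex α) (x : Finset α) (hx : x ∈ G.faces)
      (hS : IsContractible (unitSphere G x)) (hD : IsContractible (deleteStar G x)) :
      IsContractible G

/-- `IsSphere d G`: `G` is a `d`-sphere. The empty complex is the `(-1)`-sphere. For `d ≥ 0`, `G` is
a `d`-sphere if all its unit spheres are `(d-1)`-spheres (so that `G` is a `d`-manifold) and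
`G \ U(x)` is contractible for some simplex `x` of `G`. -/
inductive IsSphere : ℤ → PreAbstractSimplicialComplex α → Prop
  | empty : IsSphere (-1) ⊥
  | step (d : ℤ) (hd : 0 ≤ d) (G : PreAbstractSimplicialComplex α)
      (hS : ∀ x ∈ G.faces, IsSphere (d - 1) (unitSphere G x))
      (hD : ∃ x ∈ G.faces, IsContractible (deleteStar G x)) : IsSphere d G

/-- `G` is a `d`-manifold: every unit sphere is a `(d-1)`-sphere. -/
def IsManifold (d : ℤ) (G : PreAbstractSimplicialComplex α) : Prop :=
  ∀ x ∈ G.faces, IsSphere (d - 1) (unitSphere G x)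

end Complexes

section Whitney

variable {β : Type*}

/-- The Whitney complex of the subgraph of `Γ` induced on the set `A` of nodes: its simplices are
the nonempty finite sets of nodes in `A` that are pairwise adjacent. -/
def whitney (Γ : SimpleGraph β) (A : Set β) : PreAbstractSimplicialComplex β where
  faces := {X | X.Nonempty ∧ (X : Set β) ⊆ A ∧ Γ.IsClique (X : Set β)}
  isRelLowerSet_faces := by
    rintro X ⟨hne, hA, hX⟩
    refine ⟨hne, fun Y hYX hY => ⟨hY, ?_, ?_⟩⟩
    · exact (Finset.coe_subset.2 hYX).trans hA
    · exact hX.subset (Finset.coe_subset.2 hYX)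

end Whitney

section Levels

variable {α : Type*}

/-- Two different finite sets are adjacent if one of them is contained in the other. -/
def inclusionGraph (α : Type*) : SimpleGraph (Finset α) where
  Adj x y := x ≠ y ∧ (x ⊆ y ∨ y ⊆ x)
  symm := ⟨fun _ _ h => ⟨h.1.symm, h.2.symm⟩⟩
  loopless := ⟨fun _ h => h.1 rfl⟩

/-- The Barycentric refinement `G₁`. -/
def barycentric (G : PreAbstractSimplicialComplex α) : PreAbstractSimplicialComplex (Finset α) :=
  whitney (inclusionGraph α) G.faces

/-- `f` is locally injective on the vertices of `G`: `f v ≠ f w` for all vertices `w` of `S(v)`.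
A vertex of `G` is a `v : α` with `{v} ∈ G`; values of `f` outside of the vertices play no role. -/
def LocallyInjective {R : Type*} (G : PreAbstractSimplicialComplex α) (f : α → R) : Prop :=
  ∀ v w : α, {v} ∈ G.faces → {w} ∈ (unitSphere G {v}).faces → f v ≠ f w

/-- `f - c` changes sign on the simplex `x`. -/
def ChangesSign {R : Type*} [Ring R] [LinearOrder R] (f : α → R) (c : R) (x : Finset α) : Prop :=
  (∃ v ∈ x, f v - c < 0) ∧ ∃ w ∈ x, 0 < f w - c

/-- The level set `{f = c}`: the Whitney complex of the graph whose nodes are the simplices of `G` on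
which `f - c` changes sign, two of them being adjacent if one is contained in the other. -/
def levelSet {R : Type*} [Ring R] [LinearOrder R] (G : PreAbstractSimplicialComplex α)
    (f : α → R) (c : R) : PreAbstractSimplicialComplex (Finset α) :=
  whitney (inclusionGraph α) {x | x ∈ G.faces ∧ ChangesSign f c x}

end Levels

end DiscreteSard

/-! A simplex of the level set is a nonempty chain of sign-changing simplices of `G`. Hence the unit
sphere of a vertex x of the level set is the join of the complex of chains strictly below x with the
complex of chains strictly above x.

Above x every simplex of `G` changes sign, and y ↦ y \ x identifies the chains with the barycentric
subdivision of the link of x, a sphere of dimension d - |x|. Below x, since c is not a value of f,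
the vertices of x split into a negative part A and a positive part B. Complementation y ↦ x \ y
turns the proper faces meeting both parts into the simplices of the join ∂A * ∂B, a sphere of
dimension |x| - 3. The join of the two pieces has dimension (|x| - 3) + (d - |x|) + 1 = d - 2, as
required.

Three general facts carry this. Joins of spheres are spheres (`IsVertexSphere.join`). The sphere
condition need only be tested at vertices, because S(x) is the join of ∂x with the link of x
(`unitSphere_eq_join`, `IsVertexSphere.isSphere`). Barycentric subdivision preserves spheres
(`IsVertexSphere.subdivision`), because it is a sequence of stellar subdivisions, each of which
preserves contractibility and spheres. -/

namespace DiscreteSard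

/-! ### Complexes with the empty simplex adjoined; links, joins and simplex boundaries. -/

section Augmented

variable {α : Type*}

/-- The simplices of `G` together with the empty set. -/
def aug (G : PreAbstractSimplicialComplex α) : Set (Finset α) := insert ∅ G.faces

/-- The complex of nonempty members of a family of finite sets closed under subsets. -/
def ofAug (s : Set (Finset α)) (h : ∀ z ∈ s, ∀ y, y ⊆ z → y ∈ s) :
    PreAbstractSimplicialComplex α where
  faces := {z | z.Nonempty ∧ z ∈ s}
  isRelLowerSet_faces := by
    rintro z ⟨hz, hzs⟩
    exact ⟨hz, fun t ht hne => ⟨hne, h z hzs t ht⟩⟩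

variable {G H : PreAbstractSimplicialComplex α} {x y z : Finset α}

theorem nonempty_of_mem_faces (h : z ∈ G.faces) : z.Nonempty := (G.isRelLowerSet_faces h).1

theorem mem_aug : z ∈ aug G ↔ z = ∅ ∨ z ∈ G.faces := Iff.rfl

theorem empty_mem_aug : ∅ ∈ aug G := Or.inl rfl

theorem mem_aug_of_mem (h : z ∈ G.faces) : z ∈ aug G := Or.inr h

theorem mem_faces_iff : z ∈ G.faces ↔ z.Nonempty ∧ z ∈ aug G := by
  refine ⟨fun h => ⟨nonempty_of_mem_faces h, Or.inr h⟩, ?_⟩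
  rintro ⟨h, rfl | h'⟩
  · exact absurd h (by simp)
  · exact h'

theorem aug_mono (h : z ∈ aug G) (hy : y ⊆ z) : y ∈ aug G := by
  rcases y.eq_empty_or_nonempty with rfl | hne
  · exact empty_mem_aug
  rcases h with rfl | h
  · exact absurd hne (by simp [Finset.subset_empty.1 hy])
  · exact Or.inr ((G.isRelLowerSet_faces h).2 hy hne)

/-- The identities between constructed complexes below are checked in this form: once the empty
simplex is admitted, membership in links, joins and unit spheres is pure set algebra, without
nonemptiness cases. -/
theorem ext_aug (h : ∀ z, z ∈ aug G ↔ z ∈ aug H) : G = H := by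
  apply PreAbstractSimplicialComplex.ext
  ext z
  rw [mem_faces_iff, mem_faces_iff, h]

theorem mem_aug_ofAug {s : Set (Finset α)} {h} (h0 : ∅ ∈ s) : z ∈ aug (ofAug s h) ↔ z ∈ s := by
  rw [mem_aug]
  rcases z.eq_empty_or_nonempty with rfl | hne
  · simp [h0]
  · simp [ofAug, hne, hne.ne_empty]

theorem mem_aug_bot : z ∈ aug (⊥ : PreAbstractSimplicialComplex α) ↔ z = ∅ := by
  constructor
  · rintro (h | h)
    · exact h
    · exact h.elim
  · exact Or.inl

theorem eq_bot_of_faces (h : ∀ z, z ∉ G.faces) : G = ⊥ :=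
  ext_aug fun z => by rw [mem_aug_bot, mem_aug]; simp [h]

theorem aug_finite (h : G.faces.Finite) : (aug G).Finite := h.insert ∅

theorem faces_finite_of_aug (h : (aug G).Finite) : G.faces.Finite :=
  h.subset (Set.subset_insert _ _)

theorem mem_aug_deleteStar (hx : x.Nonempty) :
    z ∈ aug (deleteStar G x) ↔ z ∈ aug G ∧ ¬ x ⊆ z := by
  rcases z.eq_empty_or_nonempty with rfl | hz
  · simp [empty_mem_aug, Finset.subset_empty, hx.ne_empty]
  · simp only [mem_aug, hz.ne_empty, false_or]
    exact ⟨fun h => ⟨h.1, fun h' => h.2 ⟨h.1, h'⟩⟩, fun h => ⟨h.1, fun h' => h.2 h'.2⟩⟩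

theorem unitSphere_finite (h : G.faces.Finite) : (unitSphere G x).faces.Finite :=
  h.subset fun _ hz => hz.1.1

theorem deleteStar_finite (h : G.faces.Finite) : (deleteStar G x).faces.Finite :=
  h.subset fun _ hz => hz.1

theorem singleton_mem_of_mem_aug {v : α} (hz : z ∈ aug G) (hv : v ∈ z) : {v} ∈ G.faces :=
  mem_faces_iff.2 ⟨by simp, aug_mono hz (by simpa using hv)⟩

variable [DecidableEq α]

/-- If some simplex contains both z and x, then z ∪ x is the smallest such simplex, which removes
the existential from the unit ball. -/
theorem mem_aug_unitSphere (hx : x ∈ G.faces) :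
    z ∈ aug (unitSphere G x) ↔ z ∪ x ∈ aug G ∧ ¬ x ⊆ z := by
  have hxn := nonempty_of_mem_faces hx
  rcases z.eq_empty_or_nonempty with rfl | hz
  · simp [empty_mem_aug, Finset.subset_empty, hxn.ne_empty, mem_aug_of_mem hx]
  · simp only [mem_aug, hz.ne_empty, false_or, Finset.union_eq_empty, false_and]
    constructor
    · rintro ⟨⟨hzG, y, hy, hzy⟩, hn⟩
      exact ⟨(G.isRelLowerSet_faces hy.1).2 (Finset.union_subset hzy hy.2) (by simp [hz]),
        fun h => hn ⟨hzG, h⟩⟩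
    · rintro ⟨h, hn⟩
      exact ⟨⟨(G.isRelLowerSet_faces h).2 Finset.subset_union_left hz, z ∪ x,
        ⟨h, Finset.subset_union_right⟩, Finset.subset_union_left⟩, fun h' => hn h'.2⟩

/-- The simplices `z` disjoint from `x` with `z ∪ x ∈ G`. -/
def link (G : PreAbstractSimplicialComplex α) (x : Finset α) : PreAbstractSimplicialComplex α :=
  ofAug {z | z ∪ x ∈ aug G ∧ Disjoint z x} fun _ hz _ hy =>
    ⟨aug_mono hz.1 (Finset.union_subset_union_left hy), hz.2.mono_left hy⟩

theorem mem_aug_link (hx : x ∈ aug G) : z ∈ aug (link G x) ↔ z ∪ x ∈ aug G ∧ Disjoint z x :=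
  mem_aug_ofAug (by simpa using hx)

/-- The join of a complex with vertices in `V` and a complex with vertices outside of `V`. -/
def join (V : Finset α) (A B : PreAbstractSimplicialComplex α) : PreAbstractSimplicialComplex α :=
  ofAug {z | z ∩ V ∈ aug A ∧ z \ V ∈ aug B} fun _ hz _ hy =>
    ⟨aug_mono hz.1 (Finset.inter_subset_inter_right hy),
      aug_mono hz.2 (Finset.sdiff_subset_sdiff hy subset_rfl)⟩

theorem mem_aug_join {V : Finset α} {A B : PreAbstractSimplicialComplex α} :
    z ∈ aug (join V A B) ↔ z ∩ V ∈ aug A ∧ z \ V ∈ aug B :=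
  mem_aug_ofAug (by simp [empty_mem_aug])

/-- The boundary complex of a simplex. -/
def simplexBoundary (x : Finset α) : PreAbstractSimplicialComplex α :=
  ofAug {z | z ⊂ x} fun _ hz _ hy => lt_of_le_of_lt hy hz

omit [DecidableEq α] in
theorem mem_aug_simplexBoundary (hx : x.Nonempty) : z ∈ aug (simplexBoundary x) ↔ z ⊂ x :=
  mem_aug_ofAug (by simpa [Finset.empty_ssubset] using hx)

end Augmented

/-! ### Cones and joins with a contractible factor are contractible. -/

section Cone

variable {α : Type*} [DecidableEq α]

/-- If `G` is a cone with apex `v`, then `G` is contractible. -/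
theorem isContractible_of_cone (G : PreAbstractSimplicialComplex α) (hfin : G.faces.Finite) (v : α)
    (hG : ∀ z ∈ aug G, insert v z ∈ aug G) : IsContractible G := by
  induction hn : G.faces.ncard using Nat.strong_induction_on generalizing G with
  | _ n ih =>
    subst hn
    -- Removing a simplex without v leaves two smaller cones with apex v. When none is left, only
    -- {v} remains: any other z would have the face z \ {v}.
    by_cases h : ∃ x ∈ G.faces, v ∉ x
    · obtain ⟨x, hx, hv⟩ := h
      have hxn := nonempty_of_mem_faces hx
      refine IsContractible.step G x hx ?_ ?_
      · refine ih _ (Set.ncard_lt_ncard ⟨fun z hz => hz.1.1, fun h => ?_⟩ hfin) _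
          (unitSphere_finite hfin) ?_ rfl
        · exact (h hx).2 ⟨hx, subset_rfl⟩
        · intro z hz
          rw [mem_aug_unitSphere hx] at hz ⊢
          refine ⟨by rw [Finset.insert_union]; exact hG _ hz.1, ?_⟩
          rw [Finset.subset_insert_iff_of_notMem hv]
          exact hz.2
      · refine ih _ (Set.ncard_lt_ncard ⟨fun z hz => hz.1, fun h => ?_⟩ hfin) _
          (deleteStar_finite hfin) ?_ rfl
        · exact (h hx).2 ⟨hx, subset_rfl⟩
        · intro z hz
          rw [mem_aug_deleteStar hxn] at hz ⊢
          refine ⟨hG _ hz.1, ?_⟩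
          rw [Finset.subset_insert_iff_of_notMem hv]
          exact hz.2
    · push Not at h
      refine IsContractible.point G v ?_
      ext z
      simp only [Set.mem_singleton_iff]
      constructor
      · intro hz
        by_contra hne
        have hvz := h z hz
        have : (z.erase v).Nonempty := by
          rw [Finset.nonempty_iff_ne_empty, Ne, Finset.erase_eq_empty_iff]
          rintro (h1 | h1)
          · simp [h1] at hvz
          · exact hne h1
        have := h (z.erase v) ((G.isRelLowerSet_faces hz).2 (Finset.erase_subset _ _) this)
        simp at this
      · rintro rfl
        exact mem_faces_iff.2 ⟨by simp, by simpa using hG ∅ empty_mem_aug⟩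

theorem join_finite {V : Finset α} {A B : PreAbstractSimplicialComplex α} (hA : A.faces.Finite)
    (hB : B.faces.Finite) : (join V A B).faces.Finite := by
  apply faces_finite_of_aug
  refine (Set.Finite.image2 (· ∪ ·) (aug_finite hA) (aug_finite hB)).subset fun z hz => ?_
  rw [mem_aug_join] at hz
  exact ⟨_, hz.1, _, hz.2, by grind⟩

theorem deleteStar_join_left {V x : Finset α} (A B : PreAbstractSimplicialComplex α)
    (hx : x.Nonempty) (hV : x ⊆ V) :
    deleteStar (join V A B) x = join V (deleteStar A x) B := by
  refine ext_aug fun z => ?_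
  simp only [mem_aug_deleteStar hx, mem_aug_join, Finset.subset_inter_iff]
  tauto

theorem mem_join_left {V x : Finset α} {A B : PreAbstractSimplicialComplex α} (hx : x ∈ A.faces)
    (hV : x ⊆ V) : x ∈ (join V A B).faces := by
  rw [mem_faces_iff, mem_aug_join, Finset.inter_eq_left.2 hV, Finset.sdiff_eq_empty_iff_subset.2 hV]
  exact ⟨nonempty_of_mem_faces hx, mem_aug_of_mem hx, empty_mem_aug⟩

theorem mem_join_right {V x : Finset α} {A B : PreAbstractSimplicialComplex α} (hx : x ∈ B.faces)
    (hV : Disjoint x V) : x ∈ (join V A B).faces := by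
  rw [mem_faces_iff, mem_aug_join, Finset.disjoint_iff_inter_eq_empty.1 hV,
    Finset.sdiff_eq_self_of_disjoint hV]
  exact ⟨nonempty_of_mem_faces hx, empty_mem_aug, mem_aug_of_mem hx⟩

theorem unitSphere_join_left {V x : Finset α} (A B : PreAbstractSimplicialComplex α)
    (hx : x ∈ A.faces) (hV : x ⊆ V) :
    unitSphere (join V A B) x = join V (unitSphere A x) B := by
  refine ext_aug fun z => ?_
  have h1 : (z ∪ x) ∩ V = z ∩ V ∪ x := by grind
  have h2 : (z ∪ x) \ V = z \ V := by grind
  simp only [mem_aug_unitSphere (mem_join_left hx hV), mem_aug_join, mem_aug_unitSphere hx,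
    Finset.subset_inter_iff, h1, h2]
  tauto

theorem unitSphere_join_right {V x : Finset α} (A B : PreAbstractSimplicialComplex α)
    (hx : x ∈ B.faces) (hV : Disjoint x V) :
    unitSphere (join V A B) x = join V A (unitSphere B x) := by
  refine ext_aug fun z => ?_
  have h1 : (z ∪ x) ∩ V = z ∩ V := by
    rw [Finset.union_inter_distrib_right, Finset.disjoint_iff_inter_eq_empty.1 hV]; simp
  have h2 : (z ∪ x) \ V = z \ V ∪ x := by
    rw [Finset.union_sdiff_distrib, Finset.sdiff_eq_self_of_disjoint hV]
  simp only [mem_aug_unitSphere (mem_join_right hx hV), mem_aug_join, mem_aug_unitSphere hx,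
    Finset.subset_sdiff, h1, h2]
  tauto

/-- Taking S(x) and deleting U(x) for x in the left factor commute with the join, so a contraction
of A carries over step by step. It ends at the join of a point with B, which is a cone. -/
theorem IsContractible.join {A : PreAbstractSimplicialComplex α} (hA : IsContractible A)
    {V : Finset α} (hAV : ∀ z ∈ aug A, z ⊆ V) (B : PreAbstractSimplicialComplex α)
    (hA' : A.faces.Finite) (hB : B.faces.Finite) :
    IsContractible (join V A B) := by
  induction hA with
  | point G v hG =>
    have hv : v ∈ V := by simpa using hAV {v} (Or.inr (by simp [hG]))
    refine isContractible_of_cone _ (join_finite hA' hB) v fun z hz => ?_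
    rw [mem_aug_join] at hz ⊢
    rw [Finset.insert_inter_of_mem hv, Finset.insert_sdiff_of_mem _ hv]
    refine ⟨?_, hz.2⟩
    have h1 := hz.1
    simp only [mem_aug, hG, Set.mem_singleton_iff] at h1 ⊢
    rcases h1 with h1 | h1 <;> simp [h1]
  | step G x hx hS hD ihS ihD =>
    have hxV := hAV x (mem_aug_of_mem hx)
    have hxn := nonempty_of_mem_faces hx
    refine IsContractible.step _ x (mem_join_left hx hxV) ?_ ?_
    · rw [unitSphere_join_left _ _ hx hxV]
      refine ihS (fun z hz => ?_) (unitSphere_finite hA')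
      rw [mem_aug_unitSphere hx] at hz
      exact Finset.subset_union_left.trans (hAV _ hz.1)
    · rw [deleteStar_join_left _ _ hxn hxV]
      refine ihD (fun z hz => ?_) (deleteStar_finite hA')
      rw [mem_aug_deleteStar hxn] at hz
      exact hAV _ hz.1

end Cone

/-! ### Spheres tested at vertices, their joins and their links. -/

section Spheres

variable {α : Type*}

/-- Finite spheres defined by the unit spheres of vertices only. -/
inductive IsVertexSphere : ℤ → PreAbstractSimplicialComplex α → Prop
  | empty : IsVertexSphere (-1) ⊥
  | step (d : ℤ) (hd : 0 ≤ d) (G : PreAbstractSimplicialComplex α) (hfin : G.faces.Finite)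
      (hS : ∀ v, {v} ∈ G.faces → IsVertexSphere (d - 1) (unitSphere G {v}))
      (hD : ∃ x ∈ G.faces, IsContractible (deleteStar G x)) : IsVertexSphere d G

variable {G : PreAbstractSimplicialComplex α} {d : ℤ}

theorem IsVertexSphere.finite (h : IsVertexSphere d G) : G.faces.Finite := by
  cases h with
  | empty => exact Set.finite_empty
  | step _ _ _ hfin => exact hfin

theorem IsVertexSphere.unitSphere (h : IsVertexSphere d G) {v : α} (hv : {v} ∈ G.faces) :
    IsVertexSphere (d - 1) (unitSphere G {v}) := by
  cases h with
  | empty => exact hv.elim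
  | step _ _ _ _ hS => exact hS v hv

variable [DecidableEq α]

omit [DecidableEq α] in
theorem IsSphere.isVertexSphere (h : IsSphere d G) (hfin : G.faces.Finite) :
    IsVertexSphere d G := by
  induction h with
  | empty => exact .empty
  | step d hd G hS hD ih =>
    exact .step d hd G hfin (fun v hv => ih _ hv (unitSphere_finite hfin)) hD

/-- Double induction: the unit sphere at a vertex is the join of one factor with the unit sphere in
the other, and the empty complex is neutral. Deleting a star in A gives a join with a contractible
left factor. The shift by 1 matches the (-1)-sphere being the unit of the join. -/
theorem IsVertexSphere.join {p q : ℤ} {A B : PreAbstractSimplicialComplex α}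
    (hA : IsVertexSphere p A) (hB : IsVertexSphere q B) {V : Finset α}
    (hAV : ∀ z ∈ aug A, z ⊆ V) (hBV : ∀ z ∈ aug B, Disjoint z V) :
    IsVertexSphere (p + q + 1) (join V A B) := by
  induction hA generalizing q B with
  | empty =>
    have : DiscreteSard.join V ⊥ B = B := by
      refine ext_aug fun z => ?_
      rw [mem_aug_join, mem_aug_bot]
      constructor
      · rintro ⟨h1, h2⟩
        rwa [Finset.sdiff_eq_self_of_disjoint (Finset.disjoint_iff_inter_eq_empty.2 h1)] at h2
      · intro h
        rw [Finset.disjoint_iff_inter_eq_empty.1 (hBV z h),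
          Finset.sdiff_eq_self_of_disjoint (hBV z h)]
        exact ⟨rfl, h⟩
    rw [this]
    convert hB using 1
    ring
  | step p hp A hfin hS hD ih =>
    have hA := IsVertexSphere.step p hp A hfin hS hD
    induction hB with
    | empty =>
      have : DiscreteSard.join V A ⊥ = A := by
        refine ext_aug fun z => ?_
        rw [mem_aug_join, mem_aug_bot, Finset.sdiff_eq_empty_iff_subset]
        constructor
        · rintro ⟨h1, h2⟩
          rwa [Finset.inter_eq_left.2 h2] at h1
        · intro h
          rw [Finset.inter_eq_left.2 (hAV z h)]
          exact ⟨h, hAV z h⟩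
      rw [this]
      convert hA using 1
      ring
    | step q hq B hfinB hSB hDB ihB =>
      have hB := IsVertexSphere.step q hq B hfinB hSB hDB
      refine .step _ (by omega) _ (join_finite hfin hfinB) ?_ ?_
      · intro v hv
        rw [mem_faces_iff, mem_aug_join] at hv
        by_cases hvV : v ∈ V
        · have hvA : {v} ∈ A.faces := by
            rw [mem_faces_iff]
            have := hv.2.1
            rw [Finset.inter_eq_left.2 (by simpa using hvV)] at this
            exact ⟨by simp, this⟩
          rw [unitSphere_join_left _ _ hvA (by simpa using hvV)]
          convert ih v hvA hB (fun z hz => ?_) hBV using 1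
          · ring
          · rw [mem_aug_unitSphere hvA] at hz
            exact Finset.subset_union_left.trans (hAV _ hz.1)
        · have hd : Disjoint {v} V := by simpa using hvV
          have hvB : {v} ∈ B.faces := by
            rw [mem_faces_iff]
            have := hv.2.2
            rw [Finset.sdiff_eq_self_of_disjoint hd] at this
            exact ⟨by simp, this⟩
          rw [unitSphere_join_right _ _ hvB hd]
          convert ihB v hvB (fun z hz => ?_) using 1
          · ring
          · rw [mem_aug_unitSphere hvB] at hz
            exact (hBV _ hz.1).mono_left Finset.subset_union_left
      · obtain ⟨x, hx, hxc⟩ := hD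
        have hxV := hAV x (mem_aug_of_mem hx)
        have hxn := nonempty_of_mem_faces hx
        refine ⟨x, mem_join_left hx hxV, ?_⟩
        rw [deleteStar_join_left _ _ hxn hxV]
        refine hxc.join (fun z hz => ?_) B (deleteStar_finite hfin) hfinB
        rw [mem_aug_deleteStar hxn] at hz
        exact hAV _ hz.1

omit [DecidableEq α] in
theorem simplexBoundary_finite (x : Finset α) : (simplexBoundary x).faces.Finite :=
  (x.powerset.finite_toSet).subset fun _ hz => by simpa using hz.2.1

theorem isVertexSphere_simplexBoundary {x : Finset α} (hx : x.Nonempty) :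
    IsVertexSphere (x.card - 2) (simplexBoundary x) := by
  induction hn : x.card using Nat.strong_induction_on generalizing x with
  | _ n ih =>
    subst hn
    have h1 := hx.card_pos
    rcases Nat.lt_or_ge 1 x.card with h2 | h2
    · have hsing : ∀ {v}, v ∈ x → {v} ∈ (simplexBoundary x).faces := by
        intro v hv
        rw [mem_faces_iff, mem_aug_simplexBoundary hx]
        refine ⟨by simp, (Finset.ssubset_iff_subset_ne.2 ⟨by simpa using hv, ?_⟩)⟩
        rintro rfl
        simp at h2
      refine .step _ (by omega) _ (simplexBoundary_finite x) ?_ ?_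
      · intro v hv
        have hvx : v ∈ x := by simpa using hv.2.1
        have hne : (x.erase v).Nonempty := by
          rw [← Finset.card_pos, Finset.card_erase_of_mem hvx]; omega
        have : unitSphere (simplexBoundary x) {v} = simplexBoundary (x.erase v) := by
          refine ext_aug fun z => ?_
          rw [mem_aug_unitSphere hv, mem_aug_simplexBoundary hx, mem_aug_simplexBoundary hne]
          grind
        rw [this]
        convert ih _ (Finset.card_erase_lt_of_mem hvx) hne rfl using 1
        rw [Finset.card_erase_of_mem hvx]
        omega
      · obtain ⟨v, hv⟩ := hx
        refine ⟨{v}, hsing hv, ?_⟩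
        -- Without the star of v, the boundary of x is the full simplex on x \ {v}, a cone over any
        -- of its vertices.
        obtain ⟨w, hw⟩ : (x.erase v).Nonempty := by
          rw [← Finset.card_pos, Finset.card_erase_of_mem hv]; omega
        refine isContractible_of_cone _ (deleteStar_finite (simplexBoundary_finite x)) w ?_
        intro z
        rw [mem_aug_deleteStar (by simp), mem_aug_deleteStar (by simp),
          mem_aug_simplexBoundary ⟨v, hv⟩, mem_aug_simplexBoundary ⟨v, hv⟩]
        grind
    · obtain ⟨v, rfl⟩ := Finset.card_eq_one.1 (le_antisymm h2 h1)
      have : simplexBoundary {v} = ⊥ := by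
        refine ext_aug fun z => ?_
        rw [mem_aug_simplexBoundary (by simp), mem_aug_bot, Finset.ssubset_singleton_iff]
      rw [this]
      exact .empty

/-- In a complex whose vertices have spheres as unit spheres, links are spheres. -/
theorem isVertexSphere_link (hG : ∀ v, {v} ∈ G.faces → IsVertexSphere (d - 1) (unitSphere G {v}))
    {x : Finset α} (hx : x ∈ G.faces) : IsVertexSphere (d - x.card) (link G x) := by
  induction x using Finset.induction_on generalizing G d with
  | empty => exact absurd (nonempty_of_mem_faces hx) (by simp)
  | insert v y hv ih =>
    have hvG : {v} ∈ G.faces :=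
      mem_faces_iff.2 ⟨by simp, aug_mono (mem_aug_of_mem hx) (by simp)⟩
    have hy : y ∈ aug (unitSphere G {v}) := by
      rw [mem_aug_unitSphere hvG]
      exact ⟨aug_mono (mem_aug_of_mem hx) (by grind), by simpa using hv⟩
    -- Links are iterated vertex unit spheres: each vertex of x lowers the dimension by one.
    have hlink : link G (insert v y) = link (unitSphere G {v}) y := by
      refine ext_aug fun z => ?_
      rw [mem_aug_link (mem_aug_of_mem hx), mem_aug_link hy, mem_aug_unitSphere hvG,
        show z ∪ y ∪ {v} = z ∪ insert v y by grind]
      simp only [Finset.disjoint_insert_right, Finset.singleton_subset_iff, Finset.mem_union]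
      tauto
    rw [hlink]
    rcases hy with rfl | hy
    · have : link (unitSphere G {v}) ∅ = unitSphere G {v} :=
        ext_aug fun z => by simp [mem_aug_link empty_mem_aug]
      rw [this]
      simpa using hG v hvG
    · convert ih (fun w hw => (hG v hvG).unitSphere hw) hy using 1
      rw [Finset.card_insert_of_notMem hv]
      push_cast
      ring

/-- A simplex z of S(x) splits into z ∩ x, a proper subset of x, and z \ x, a simplex of the link;
the two parts are independent. -/
theorem unitSphere_eq_join {x : Finset α} (hx : x ∈ G.faces) :
    unitSphere G x = join x (simplexBoundary x) (link G x) := by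
  refine ext_aug fun z => ?_
  rw [mem_aug_unitSphere hx, mem_aug_join, mem_aug_simplexBoundary (nonempty_of_mem_faces hx),
    mem_aug_link (mem_aug_of_mem hx), Finset.sdiff_union_self_eq_union]
  have : Disjoint (z \ x) x := Finset.sdiff_disjoint
  have : z ∩ x ⊂ x ↔ ¬ x ⊆ z := by grind
  tauto

/-- The dimensions of the two join factors give (|x| - 2) + (d - |x|) + 1 = d - 1, whatever the size
of x. -/
theorem isVertexSphere_unitSphere
    (hG : ∀ v, {v} ∈ G.faces → IsVertexSphere (d - 1) (unitSphere G {v}))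
    {x : Finset α} (hx : x ∈ G.faces) : IsVertexSphere (d - 1) (unitSphere G x) := by
  have hxn := nonempty_of_mem_faces hx
  rw [unitSphere_eq_join hx]
  convert (isVertexSphere_simplexBoundary hxn).join (isVertexSphere_link hG hx) (V := x) ?_ ?_
    using 1
  · ring
  · intro z hz
    rw [mem_aug_simplexBoundary hxn] at hz
    exact hz.1
  · intro z hz
    rw [mem_aug_link (mem_aug_of_mem hx)] at hz
    exact hz.2

theorem IsVertexSphere.isSphere (h : IsVertexSphere d G) : IsSphere d G := by
  induction hn : (d + 1).toNat using Nat.strong_induction_on generalizing d G with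
  | _ n ih =>
    subst hn
    cases h with
    | empty => exact .empty
    | step _ hd _ hfin hS hD =>
      exact .step d hd G (fun x hx => ih _ (by omega) (isVertexSphere_unitSphere hS hx) rfl) hD

theorem isManifold_of_vertices
    (hG : ∀ v, {v} ∈ G.faces → IsVertexSphere (d - 1) (DiscreteSard.unitSphere G {v})) :
    IsManifold d G :=
  fun _ hx => (isVertexSphere_unitSphere hG hx).isSphere

end Spheres

/-! ### Stellar subdivision preserves contractibility and spheres. -/

section Stellar

variable {α : Type*} [DecidableEq α] {G : PreAbstractSimplicialComplex α} {x z u : Finset α} {a : α}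

/-- The stellar subdivision of `G` at `x` with new vertex `a`. If `x` is not a simplex of `G`,
nothing changes. -/
def stellar (G : PreAbstractSimplicialComplex α) (x : Finset α) (a : α) :
    PreAbstractSimplicialComplex α :=
  ofAug {u | ¬ x ⊆ u ∧ (a ∈ u → u.erase a ∪ x ∈ aug G) ∧ (a ∉ u → u ∈ aug G)} fun z hz y hy => by
    refine ⟨fun h => hz.1 (h.trans hy), fun ha => ?_, fun ha => ?_⟩
    · exact aug_mono (hz.2.1 (hy ha)) (by grind)
    · by_cases haz : a ∈ z
      · exact aug_mono (hz.2.1 haz) (by grind)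
      · exact aug_mono (hz.2.2 haz) hy

theorem mem_aug_stellar (hx : x.Nonempty) : u ∈ aug (stellar G x a) ↔
    ¬ x ⊆ u ∧ (a ∈ u → u.erase a ∪ x ∈ aug G) ∧ (a ∉ u → u ∈ aug G) :=
  mem_aug_ofAug (by simp [Finset.subset_empty, hx.ne_empty, empty_mem_aug])

theorem stellar_finite (hx : x.Nonempty) (hG : G.faces.Finite) :
    (stellar G x a).faces.Finite := by
  apply faces_finite_of_aug
  refine ((aug_finite hG).union ((aug_finite hG).image (insert a))).subset fun u hu => ?_
  rw [mem_aug_stellar hx] at hu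
  by_cases ha : a ∈ u
  · exact Or.inr ⟨u.erase a, aug_mono (hu.2.1 ha) Finset.subset_union_left, by grind⟩
  · exact Or.inl (hu.2.2 ha)

omit [DecidableEq α] in
theorem notMem_of_mem_aug (ha : {a} ∉ G.faces) (hz : z ∈ aug G) : a ∉ z :=
  fun h => ha (singleton_mem_of_mem_aug hz h)

/-- Needed because inductions pass to unit spheres and star deletions, where x may no longer be a
simplex. -/
theorem stellar_of_notMem (hx : x.Nonempty) (ha : {a} ∉ G.faces) (h : x ∉ G.faces) :
    stellar G x a = G := by
  have h' : ∀ z, x ⊆ z → z ∉ aug G := fun z hz h1 => h (mem_faces_iff.2 ⟨hx, aug_mono h1 hz⟩)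
  refine ext_aug fun u => ?_
  rw [mem_aug_stellar hx]
  constructor
  · rintro ⟨h1, h2, h3⟩
    by_cases ha : a ∈ u
    · exact absurd (h2 ha) (h' _ Finset.subset_union_right)
    · exact h3 ha
  · intro hu
    exact ⟨fun h1 => h' u h1 hu, fun h1 => absurd h1 (notMem_of_mem_aug ha hu), fun _ => hu⟩

theorem mem_stellar_of_not_subset (hx : x.Nonempty) (ha : {a} ∉ G.faces) (hz : z ∈ G.faces)
    (hxz : ¬ x ⊆ z) : z ∈ (stellar G x a).faces := by
  rw [mem_faces_iff, mem_aug_stellar hx]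
  have := notMem_of_mem_aug ha (mem_aug_of_mem hz)
  exact ⟨nonempty_of_mem_faces hz, hxz, fun h => absurd h this, fun _ => mem_aug_of_mem hz⟩

/-- A simplex z ⊇ x disappears in the subdivision. This simplex takes its place: its unit sphere and
star deletion are the subdivisions of those of z. -/
theorem apex_mem_stellar (hx : x.Nonempty) (ha : {a} ∉ G.faces) (hz : z ∈ G.faces) (hxz : x ⊆ z) :
    insert a (z \ x) ∈ (stellar G x a).faces := by
  have haz := notMem_of_mem_aug ha (mem_aug_of_mem hz)
  rw [mem_faces_iff, mem_aug_stellar hx,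
    show (insert a (z \ x)).erase a ∪ x = z by grind]
  obtain ⟨v, hv⟩ := hx
  exact ⟨by simp, by grind, fun _ => mem_aug_of_mem hz, by grind⟩

theorem unitSphere_stellar_apex (ha : {a} ∉ G.faces) (hz : z ∈ G.faces) (hxz : x ⊆ z)
    (hx : x.Nonempty) :
    unitSphere (stellar G x a) (insert a (z \ x)) = stellar (unitSphere G z) x a := by
  have haz := notMem_of_mem_aug ha (mem_aug_of_mem hz)
  refine ext_aug fun u => ?_
  rw [mem_aug_unitSphere (apex_mem_stellar hx ha hz hxz), mem_aug_stellar hx, mem_aug_stellar hx,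
    mem_aug_unitSphere hz, mem_aug_unitSphere hz,
    show (u ∪ insert a (z \ x)).erase a ∪ x = u.erase a ∪ x ∪ z by grind]
  have e1 : x ⊆ u ∪ insert a (z \ x) ↔ x ⊆ u := by grind
  -- A simplex u through the apex stands for (u \ {a}) ∪ x in `G`, so containing the replacement of
  -- z means that this set contains z.
  have e2 : a ∈ u → (insert a (z \ x) ⊆ u ↔ z ⊆ u.erase a ∪ x) := by grind
  by_cases hau : a ∈ u
  · simp only [e1, e2 hau, hau, Finset.mem_union, true_or, not_true]
    grind only
  · have e3 : ¬ insert a (z \ x) ⊆ u := by grind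
    have e4 : ¬ x ⊆ u → ¬ z ⊆ u := fun h h' => h (hxz.trans h')
    have e5 : u.erase a ∪ x ∪ z = u ∪ z := by grind
    simp only [e1, e3, e5, hau, Finset.mem_union, Finset.mem_insert_self, or_true, not_true]
    grind only

theorem deleteStar_stellar_apex (ha : {a} ∉ G.faces) (hz : z ∈ G.faces) (hxz : x ⊆ z)
    (hx : x.Nonempty) :
    deleteStar (stellar G x a) (insert a (z \ x)) = stellar (deleteStar G z) x a := by
  have haz := notMem_of_mem_aug ha (mem_aug_of_mem hz)
  have hzn := nonempty_of_mem_faces hz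
  refine ext_aug fun u => ?_
  rw [mem_aug_deleteStar (by simp), mem_aug_stellar hx, mem_aug_stellar hx,
    mem_aug_deleteStar hzn, mem_aug_deleteStar hzn]
  by_cases hau : a ∈ u
  · have e2 : insert a (z \ x) ⊆ u ↔ z ⊆ u.erase a ∪ x := by grind
    simp only [e2, hau, not_true]
    grind only
  · have e3 : ¬ insert a (z \ x) ⊆ u := by grind
    have e4 : ¬ x ⊆ u → ¬ z ⊆ u := fun h h' => h (hxz.trans h')
    simp only [e3, hau]
    grind only

theorem unitSphere_stellar_of_not_subset (hx : x.Nonempty) (ha : {a} ∉ G.faces)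
    (hz : z ∈ G.faces) (hxz : ¬ x ⊆ z) :
    unitSphere (stellar G x a) z = stellar (unitSphere G z) (x \ z) a := by
  have haz := notMem_of_mem_aug ha (mem_aug_of_mem hz)
  have hxz' : (x \ z).Nonempty := by rwa [Finset.sdiff_nonempty]
  refine ext_aug fun u => ?_
  rw [mem_aug_unitSphere (mem_stellar_of_not_subset hx ha hz hxz), mem_aug_stellar hx,
    mem_aug_stellar hxz', mem_aug_unitSphere hz, mem_aug_unitSphere hz,
    show (u ∪ z).erase a ∪ x = u.erase a ∪ (x \ z) ∪ z by grind]
  have e1 : x ⊆ u ∪ z ↔ x \ z ⊆ u := by grind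
  have e2 : a ∈ u ∪ z ↔ a ∈ u := by grind
  have e3 : z ⊆ u.erase a ∪ (x \ z) ↔ z ⊆ u := by grind
  simp only [e1, e2, e3]
  grind only

/-- Deleting U(z) after subdividing removes less than deleting it before: the simplices containing w
= {a} ∪ (z \ x) but not z survive. Deleting the star of w as well makes the two agree, and this is a
contraction step because the unit sphere of w is a cone over any vertex of x \ z. -/
theorem isContractible_deleteStar_stellar (hx : x.Nonempty) (ha : {a} ∉ G.faces) (hax : a ∉ x)
    (hfin : G.faces.Finite) (hz : z ∈ G.faces) (hxz : ¬ x ⊆ z)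
    (h : IsContractible (stellar (deleteStar G z) x a)) :
    IsContractible (deleteStar (stellar G x a) z) := by
  have haz := notMem_of_mem_aug ha (mem_aug_of_mem hz)
  have hzn := nonempty_of_mem_faces hz
  have key : deleteStar (deleteStar (stellar G x a) z) (insert a (z \ x)) =
      stellar (deleteStar G z) x a := by
    refine ext_aug fun u => ?_
    rw [mem_aug_deleteStar (by simp), mem_aug_deleteStar hzn, mem_aug_stellar hx,
      mem_aug_stellar hx, mem_aug_deleteStar hzn, mem_aug_deleteStar hzn]
    by_cases hau : a ∈ u
    · have e2 : insert a (z \ x) ⊆ u ↔ z ⊆ u.erase a ∪ x := by grind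
      have e3 : z ⊆ u → z ⊆ u.erase a ∪ x := by grind
      simp only [e2, hau, not_true]
      grind only
    · have e3 : ¬ insert a (z \ x) ⊆ u := by grind
      simp only [e3, hau]
      grind only
  by_cases hw : insert a (z \ x) ∈ (deleteStar (stellar G x a) z).faces
  · refine .step _ _ hw ?_ (key ▸ h)
    obtain ⟨v, hv⟩ := Finset.sdiff_nonempty.2 hxz
    refine isContractible_of_cone _
      (unitSphere_finite (deleteStar_finite (stellar_finite hx hfin))) v fun u => ?_
    rw [mem_aug_unitSphere hw, mem_aug_unitSphere hw, mem_aug_deleteStar hzn,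
      mem_aug_deleteStar hzn, mem_aug_stellar hx, mem_aug_stellar hx]
    rw [Finset.mem_sdiff] at hv
    have hva : v ≠ a := fun h => hax (h ▸ hv.1)
    have e1 : z ⊆ insert v u ∪ insert a (z \ x) ↔ z ⊆ u ∪ insert a (z \ x) := by grind
    -- Since v ∉ z, containing x after adding v would put x ∩ z into u ∪ w for w = {a} ∪ (z \ x); as
    -- w contains z \ x, all of z would lie in u ∪ w.
    have e2 : ¬ z ⊆ u ∪ insert a (z \ x) → ¬ x ⊆ insert v u ∪ insert a (z \ x) := by
      intro h h'
      apply h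
      grind
    have e3 : insert a (z \ x) ⊆ insert v u ↔ insert a (z \ x) ⊆ u := by grind
    have e4 : (insert v u ∪ insert a (z \ x)).erase a ∪ x =
      (u ∪ insert a (z \ x)).erase a ∪ x := by grind
    have e5 : a ∈ u ∪ insert a (z \ x) := by simp
    have e6 : a ∈ insert v u ∪ insert a (z \ x) := by simp
    simp only [e1, e3, e4, e5, e6, not_true]
    grind only
  · have : deleteStar (deleteStar (stellar G x a) z) (insert a (z \ x)) =
        deleteStar (stellar G x a) z := by
      refine ext_aug fun u => ?_
      rw [mem_aug_deleteStar (by simp)]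
      refine ⟨And.left, fun hu => ⟨hu, fun hwu => hw ?_⟩⟩
      exact mem_faces_iff.2 ⟨by simp, aug_mono hu hwu⟩
    rwa [← this, key]

/-- Each contraction step of `G` at z is imitated at {a} ∪ (z \ x) if x ⊆ z, and at z itself
otherwise, with x replaced by x \ z in the unit sphere. -/
theorem IsContractible.stellar (hG : IsContractible G) (hfin : G.faces.Finite) (hx : x.Nonempty)
    (ha : {a} ∉ G.faces) (hax : a ∉ x) : IsContractible (stellar G x a) := by
  induction hG generalizing x with
  | point G v hG =>
    by_cases hxG : x ∈ G.faces
    · obtain rfl : x = {v} := by simpa [hG] using hxG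
      refine .point _ a ?_
      ext u
      rw [mem_faces_iff, mem_aug_stellar hx, mem_aug, mem_aug, hG]
      simp only [Set.mem_singleton_iff, Finset.singleton_subset_iff, Finset.union_eq_empty,
        Finset.singleton_ne_empty, and_false, false_or]
      constructor
      · rintro ⟨h1, h2, h3, h4⟩
        have hau : a ∈ u := by
          by_contra hau
          rcases h4 hau with rfl | rfl <;> simp at *
        have := h3 hau
        ext w
        have := congrArg (w ∈ ·) this
        grind
      · rintro rfl
        simp only [Finset.mem_singleton] at hax
        simp [Ne.symm hax]
    · rw [stellar_of_notMem hx ha hxG]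
      exact .point G v hG
  | step G z hz hS hD ihS ihD =>
    have haS : {a} ∉ (DiscreteSard.unitSphere G z).faces := fun h => ha h.1.1
    have haD : {a} ∉ (deleteStar G z).faces := fun h => ha h.1
    have hD' := ihD (deleteStar_finite hfin) hx haD hax
    by_cases hxz : x ⊆ z
    · refine .step _ _ (apex_mem_stellar hx ha hz hxz) ?_ ?_
      · rw [unitSphere_stellar_apex ha hz hxz hx]
        exact ihS (unitSphere_finite hfin) hx haS hax
      · rwa [deleteStar_stellar_apex ha hz hxz hx]
    · refine .step _ _ (mem_stellar_of_not_subset hx ha hz hxz) ?_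
        (isContractible_deleteStar_stellar hx ha hax hfin hz hxz hD')
      rw [unitSphere_stellar_of_not_subset hx ha hz hxz]
      exact ihS (unitSphere_finite hfin) (Finset.sdiff_nonempty.2 hxz) haS (by grind)

theorem unitSphere_stellar_singleton (hx : x ∈ G.faces) (ha : {a} ∉ G.faces) :
    unitSphere (stellar G x a) {a} = unitSphere G x := by
  have hxn := nonempty_of_mem_faces hx
  have := unitSphere_stellar_apex ha hx subset_rfl hxn
  rw [Finset.sdiff_self, stellar_of_notMem (G := unitSphere G x) hxn (fun h => ha h.1.1)
    (fun h => h.2 ⟨hx, subset_rfl⟩)] at this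
  simpa using this

/-- The unit sphere at the new vertex is S(x), a sphere already. At an old vertex v it is a
subdivision of S(v), to which induction applies. -/
theorem IsVertexSphere.stellar {d : ℤ} (hG : IsVertexSphere d G) (hx : x.Nonempty)
    (ha : {a} ∉ G.faces) (hax : a ∉ x) : IsVertexSphere d (stellar G x a) := by
  induction hG generalizing x with
  | empty => rw [stellar_of_notMem hx ha (fun h => h.elim)]; exact .empty
  | step d hd G hfin hS hD ih =>
    refine .step d hd _ (stellar_finite hx hfin) (fun v hv => ?_) ?_
    · rw [mem_faces_iff, mem_aug_stellar hx] at hv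
      obtain ⟨-, h1, h2, h3⟩ := hv
      by_cases hva : v = a
      · subst hva
        have hxG : x ∈ G.faces := by
          rw [mem_faces_iff]; exact ⟨hx, by simpa using h2⟩
        rw [unitSphere_stellar_singleton hxG ha]
        exact isVertexSphere_unitSphere hS hxG
      · have hv : {v} ∈ G.faces := by
          rw [mem_faces_iff]; exact ⟨by simp, h3 (by simpa using Ne.symm hva)⟩
        rw [unitSphere_stellar_of_not_subset hx ha hv h1]
        exact ih v hv (Finset.sdiff_nonempty.2 h1) (fun h => ha h.1.1) (by grind)
    · obtain ⟨z, hz, hzc⟩ := hD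
      have hzc' := hzc.stellar (deleteStar_finite hfin) hx (fun h => ha h.1) hax
      by_cases hxz : x ⊆ z
      · refine ⟨_, apex_mem_stellar hx ha hz hxz, ?_⟩
        rwa [deleteStar_stellar_apex ha hz hxz hx]
      · exact ⟨z, mem_stellar_of_not_subset hx ha hz hxz,
          isContractible_deleteStar_stellar hx ha hax hfin hz hxz hzc'⟩

end Stellar

/-! ### Relabelling vertices along an embedding. -/

section Comap

variable {α β : Type*}

/-- The complex of all `z` whose image under the embedding `f` is in `K`. -/
def comap (f : α ↪ β) (K : PreAbstractSimplicialComplex β) : PreAbstractSimplicialComplex α :=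
  ofAug {z | z.map f ∈ aug K} fun _ hz _ hy => aug_mono hz (Finset.map_subset_map.2 hy)

variable {f : α ↪ β} {K : PreAbstractSimplicialComplex β} {z x : Finset α}

theorem mem_aug_comap : z ∈ aug (comap f K) ↔ z.map f ∈ aug K :=
  mem_aug_ofAug (by simp [empty_mem_aug])

theorem mem_faces_comap : z ∈ (comap f K).faces ↔ z.map f ∈ K.faces := by
  rw [mem_faces_iff, mem_faces_iff, mem_aug_comap, Finset.map_nonempty]

theorem deleteStar_comap (hx : x.Nonempty) :
    deleteStar (comap f K) x = comap f (deleteStar K (x.map f)) := by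
  refine ext_aug fun z => ?_
  rw [mem_aug_comap, mem_aug_deleteStar hx, mem_aug_deleteStar (by simpa using hx), mem_aug_comap,
    Finset.map_subset_map]

theorem unitSphere_comap (hx : x.map f ∈ K.faces) :
    unitSphere (comap f K) x = comap f (unitSphere K (x.map f)) := by
  classical
  refine ext_aug fun z => ?_
  rw [mem_aug_comap, mem_aug_unitSphere (mem_faces_comap.2 hx), mem_aug_unitSphere hx,
    mem_aug_comap, Finset.map_subset_map, Finset.map_union]

theorem comap_finite (hK : K.faces.Finite) : (comap f K).faces.Finite := by
  refine (hK.preimage (f := Finset.map f) (Finset.map_injective f).injOn).subset fun z hz => ?_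
  exact mem_faces_comap.1 hz

theorem finite_of_comap (h : (comap f K).faces.Finite)
    (hK : ∀ z ∈ K.faces, ∃ y, Finset.map f y = z) : K.faces.Finite := by
  refine (h.image (Finset.map f)).subset fun z hz => ?_
  obtain ⟨y, rfl⟩ := hK z hz
  exact ⟨y, mem_faces_comap.2 hz, rfl⟩

theorem IsContractible.comap (h : IsContractible K) (hK : ∀ z ∈ K.faces, ∃ y, Finset.map f y = z) :
    IsContractible (comap f K) := by
  induction h with
  | point K v hv =>
    obtain ⟨y, hy⟩ := hK {v} (by simp [hv])
    obtain ⟨w, rfl⟩ := Finset.card_eq_one.1 (by simpa using congrArg Finset.card hy)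
    refine .point _ w ?_
    ext z
    rw [mem_faces_comap, hv, Set.mem_singleton_iff, Set.mem_singleton_iff, ← hy]
    exact (Finset.map_injective f).eq_iff
  | step K x hx hS hD ihS ihD =>
    obtain ⟨x, rfl⟩ := hK x hx
    refine .step _ x (mem_faces_comap.2 hx) ?_ ?_
    · rw [unitSphere_comap hx]
      exact ihS fun z hz => hK z hz.1.1
    · rw [deleteStar_comap (by simpa using nonempty_of_mem_faces hx)]
      exact ihD fun z hz => hK z hz.1

theorem IsContractible.of_comap (h : IsContractible (DiscreteSard.comap f K))
    (hK : ∀ z ∈ K.faces, ∃ y, Finset.map f y = z) : IsContractible K := by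
  generalize hL : DiscreteSard.comap f K = L at h
  induction h generalizing K with
  | point L v hv =>
    subst hL
    refine .point K (f v) ?_
    ext z
    rw [Set.mem_singleton_iff]
    constructor
    · intro hz
      obtain ⟨y, rfl⟩ := hK z hz
      have : y ∈ (DiscreteSard.comap f K).faces := mem_faces_comap.2 hz
      rw [hv] at this
      obtain rfl := this
      simp
    · rintro rfl
      have : {v} ∈ (DiscreteSard.comap f K).faces := by simp [hv]
      simpa using mem_faces_comap.1 this
  | step L x hx hS hD ihS ihD =>
    subst hL
    have hxK := mem_faces_comap.1 hx
    refine .step K _ hxK ?_ ?_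
    · exact ihS (fun z hz => hK z hz.1.1) (unitSphere_comap hxK).symm
    · exact ihD (fun z hz => hK z hz.1) (deleteStar_comap (nonempty_of_mem_faces hx)).symm

theorem IsVertexSphere.comap {d : ℤ} (h : IsVertexSphere d K)
    (hK : ∀ z ∈ K.faces, ∃ y, Finset.map f y = z) : IsVertexSphere d (comap f K) := by
  induction h with
  | empty =>
    rw [eq_bot_of_faces (G := DiscreteSard.comap f ⊥) fun z hz => mem_faces_comap.1 hz]
    exact .empty
  | step d hd K hfin hS hD ih =>
    refine .step d hd _ (comap_finite hfin) (fun v hv => ?_) ?_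
    · rw [mem_faces_comap] at hv
      rw [unitSphere_comap hv]
      rw [Finset.map_singleton] at hv ⊢
      exact ih _ hv fun z hz => hK z hz.1.1
    · obtain ⟨x, hx, hxc⟩ := hD
      obtain ⟨x, rfl⟩ := hK x hx
      refine ⟨x, mem_faces_comap.2 hx, ?_⟩
      rw [deleteStar_comap (by simpa using nonempty_of_mem_faces hx)]
      exact hxc.comap fun z hz => hK z hz.1

theorem IsVertexSphere.of_comap {d : ℤ} (h : IsVertexSphere d (DiscreteSard.comap f K))
    (hK : ∀ z ∈ K.faces, ∃ y, Finset.map f y = z) : IsVertexSphere d K := by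
  generalize hL : DiscreteSard.comap f K = L at h
  induction h generalizing K with
  | empty =>
    rw [eq_bot_of_faces (G := K)]
    · exact .empty
    · intro z hz
      obtain ⟨y, rfl⟩ := hK z hz
      have := mem_faces_comap.2 hz
      rw [hL] at this
      exact this.elim
  | step d hd L hfin hS hD ih =>
    subst hL
    refine .step d hd _ (finite_of_comap hfin hK) (fun v hv => ?_) ?_
    · obtain ⟨y, hy⟩ := hK _ hv
      obtain ⟨w, rfl⟩ := Finset.card_eq_one.1 (by simpa using congrArg Finset.card hy)
      rw [← hy] at hv ⊢
      exact ih w (mem_faces_comap.2 hv) (fun z hz => hK z hz.1.1) (unitSphere_comap hv).symm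
    · obtain ⟨x, hx, hxc⟩ := hD
      refine ⟨x.map f, mem_faces_comap.1 hx, ?_⟩
      rw [deleteStar_comap (nonempty_of_mem_faces hx)] at hxc
      exact hxc.of_comap fun z hz => hK z hz.1

end Comap

/-! ### Barycentric subdivision as a sequence of stellar subdivisions. -/

section Subdivision

variable {α : Type*} [DecidableEq α]

omit [DecidableEq α] in
theorem mem_aug_whitney {Q : Set (Finset α)} {z : Finset (Finset α)} :
    z ∈ aug (whitney (inclusionGraph α) Q) ↔
      (∀ y ∈ z, y ∈ Q) ∧ ∀ y ∈ z, ∀ y' ∈ z, y ⊆ y' ∨ y' ⊆ y := by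
  rcases z.eq_empty_or_nonempty with rfl | hz
  · simp [empty_mem_aug]
  rw [mem_aug]
  simp only [hz.ne_empty, false_or]
  constructor
  · rintro ⟨-, h1, h2⟩
    refine ⟨fun y hy => h1 hy, fun y hy y' hy' => ?_⟩
    by_cases h : y = y'
    · exact Or.inl h.subset
    · exact (h2 hy hy' h).2
  · rintro ⟨h1, h2⟩
    exact ⟨hz, fun y hy => h1 y hy, fun y hy y' hy' h => ⟨h, h2 y hy y' hy'⟩⟩

/-- The subdivision of `G` at the simplices in `T`, where `T` is a set of simplices of `G` that
contains with a simplex all larger ones. A simplex of `G` containing no member of `T` is combined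
with a chain in `T` of simplices that contain it. -/
def partialSubdivision (G : PreAbstractSimplicialComplex α) (T : Set (Finset α)) :
    PreAbstractSimplicialComplex (α ⊕ Finset α) :=
  ofAug {z | z.toLeft ∈ aug G ∧ (∀ t ∈ T, ¬ t ⊆ z.toLeft) ∧
      z.toRight ∈ aug (whitney (inclusionGraph α) T) ∧ ∀ c ∈ z.toRight, z.toLeft ⊆ c}
    fun _ hz _ hy => by
      have hl := Finset.toLeft_subset_toLeft hy
      have hr := Finset.toRight_subset_toRight hy
      exact ⟨aug_mono hz.1 hl, fun t ht h => hz.2.1 t ht (h.trans hl), aug_mono hz.2.2.1 hr,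
        fun c hc => hl.trans (hz.2.2.2 c (hr hc))⟩

omit [DecidableEq α] in
theorem mem_aug_partialSubdivision {G : PreAbstractSimplicialComplex α} {T : Set (Finset α)}
    (hT : T ⊆ G.faces) {z : Finset (α ⊕ Finset α)} : z ∈ aug (partialSubdivision G T) ↔
    z.toLeft ∈ aug G ∧ (∀ t ∈ T, ¬ t ⊆ z.toLeft) ∧
      z.toRight ∈ aug (whitney (inclusionGraph α) T) ∧ ∀ c ∈ z.toRight, z.toLeft ⊆ c := by
  refine mem_aug_ofAug ⟨empty_mem_aug, fun t ht h => ?_, empty_mem_aug, fun c hc => ?_⟩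
  · exact (nonempty_of_mem_faces (hT ht)).ne_empty (Finset.subset_empty.1 h)
  · exact absurd (Finset.mem_toRight.1 hc) (Finset.notMem_empty _)

/-- With every larger simplex already subdivided, the simplices of the partial subdivision
containing x consist of x and a chain above it. Starring at x replaces x by the new vertex together
with proper faces of x. -/
theorem partialSubdivision_insert {G : PreAbstractSimplicialComplex α} {T : Set (Finset α)}
    (hT : T ⊆ G.faces) {x : Finset α} (hx : x ∈ G.faces) (hxT : x ∉ T)
    (hup : ∀ t ∈ T, ∀ y ∈ G.faces, t ⊆ y → y ∈ T) (hup' : ∀ y ∈ G.faces, x ⊂ y → y ∈ T) :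
    partialSubdivision G (insert x T) =
      stellar (partialSubdivision G T) (x.map .inl) (.inr x) := by
  have hxn := nonempty_of_mem_faces hx
  have hT' : insert x T ⊆ G.faces := Set.insert_subset hx hT
  refine ext_aug fun z => ?_
  rw [mem_aug_partialSubdivision hT', mem_aug_stellar (by simpa using hxn),
    mem_aug_partialSubdivision hT, mem_aug_partialSubdivision hT,
    Finset.map_inl_subset_iff_subset_toLeft]
  have e1 : (z.erase (Sum.inr x) ∪ x.map .inl).toLeft = z.toLeft ∪ x := by ext; simp
  have e2 : (z.erase (Sum.inr x) ∪ x.map .inl).toRight = z.toRight.erase x := by ext; simp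
  have hxT' : ∀ t ∈ T, ¬ t ⊆ x := by
    intro t ht h
    exact hxT (hup t ht x hx h)
  rw [e1, e2, ← Finset.mem_toRight]
  generalize z.toLeft = l
  generalize z.toRight = r
  simp only [mem_aug_whitney, Set.mem_insert_iff, forall_eq_or_imp]
  by_cases hxr : x ∈ r
  · simp only [hxr, not_true, false_imp_iff, true_imp_iff, and_true]
    constructor
    · rintro ⟨h1, ⟨h2, h3⟩, ⟨h4, h5⟩, h6⟩
      have hlx : l ∪ x = x := Finset.union_eq_right.2 (h6 x hxr)
      rw [hlx]
      refine ⟨h2, mem_aug_of_mem hx, hxT', ⟨fun y hy => ?_, fun y hy y' hy' => ?_⟩, fun c hc => ?_⟩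
      · exact (h4 y (Finset.mem_of_mem_erase hy)).resolve_left (Finset.ne_of_mem_erase hy)
      · exact h5 y (Finset.mem_of_mem_erase hy) y' (Finset.mem_of_mem_erase hy')
      · have hcT := (h4 c (Finset.mem_of_mem_erase hc)).resolve_left (Finset.ne_of_mem_erase hc)
        exact (h5 x hxr c (Finset.mem_of_mem_erase hc)).resolve_right (hxT' c hcT)
    · rintro ⟨h1, h2, h3, ⟨h4, h5⟩, h6⟩
      -- Otherwise l ∪ x lies strictly above x and so belongs to T, while no member of T is
      -- contained in l ∪ x.
      have hlx : l ⊆ x := by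
        by_contra hlx
        refine h3 _ (hup' (l ∪ x) (mem_faces_iff.2 ⟨by simp [hxn], h2⟩) ?_) subset_rfl
        exact Finset.ssubset_iff_subset_ne.2 ⟨Finset.subset_union_right, by grind⟩
      have h7 : ∀ c ∈ r, c ≠ x → x ⊆ c := fun c hc hcx =>
        Finset.subset_union_right.trans (h6 c (Finset.mem_erase.2 ⟨hcx, hc⟩))
      refine ⟨aug_mono h2 Finset.subset_union_left,
        ⟨h1, fun t ht h => hxT' t ht (h.trans hlx)⟩, ⟨fun y hy => ?_, fun y hy y' hy' => ?_⟩,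
        fun c hc => ?_⟩
      · by_cases hyx : y = x
        · exact Or.inl hyx
        · exact Or.inr (h4 y (Finset.mem_erase.2 ⟨hyx, hy⟩))
      · by_cases hyx : y = x
        · subst hyx
          by_cases hyx' : y' = y
          · exact Or.inl hyx'.ge
          · exact Or.inl (h7 y' hy' hyx')
        · by_cases hyx' : y' = x
          · subst hyx'
            exact Or.inr (h7 y hy hyx)
          · exact h5 y (Finset.mem_erase.2 ⟨hyx, hy⟩) y' (Finset.mem_erase.2 ⟨hyx', hy'⟩)
      · by_cases hcx : c = x
        · rwa [hcx]
        · exact hlx.trans (h7 c hc hcx)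
  · simp only [hxr, not_false_eq_true, false_imp_iff, true_imp_iff, true_and]
    have : ∀ y ∈ r, (y = x ∨ y ∈ T) ↔ y ∈ T := by
      intro y hy
      have : y ≠ x := fun h => hxr (h ▸ hy)
      simp [this]
    have : (∀ y ∈ r, y = x ∨ y ∈ T) ↔ ∀ y ∈ r, y ∈ T := forall₂_congr this
    rw [this]
    tauto

theorem isVertexSphere_partialSubdivision {G : PreAbstractSimplicialComplex α} {d : ℤ}
    (hG : IsVertexSphere d G) {T : Set (Finset α)} (hT : T ⊆ G.faces)
    (hup : ∀ t ∈ T, ∀ y ∈ G.faces, t ⊆ y → y ∈ T) :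
    IsVertexSphere d (partialSubdivision G T) := by
  induction hn : T.ncard using Nat.strong_induction_on generalizing T with
  | _ n ih =>
    subst hn
    have hTfin := hG.finite.subset hT
    rcases T.eq_empty_or_nonempty with rfl | hne
    · refine IsVertexSphere.of_comap (f := .inl) ?_ fun z hz => ⟨z.toLeft, ?_⟩
      · convert hG
        refine ext_aug fun z => ?_
        rw [mem_aug_comap, mem_aug_partialSubdivision hT,
          show (z.map (.inl : α ↪ α ⊕ Finset α)).toLeft = z by ext; simp,
          show (z.map (.inl : α ↪ α ⊕ Finset α)).toRight = ∅ by ext; simp]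
        simp [empty_mem_aug]
      · have := (mem_aug_partialSubdivision hT).1 (mem_aug_of_mem hz)
        simp only [mem_aug_whitney, Set.mem_empty_iff_false] at this
        ext (y | y)
        · simp
        · simpa using fun h => this.2.2.1.1 y (by simpa using h)
    · obtain ⟨x, hx⟩ := hTfin.exists_minimal hne
      have hxT := hx.prop
      have hTx : T = insert x (T \ {x}) := by simp [Set.insert_eq_of_mem hxT]
      have hup' : ∀ t ∈ T \ {x}, ∀ y ∈ G.faces, t ⊆ y → y ∈ T \ {x} := by
        rintro t ⟨ht, htx⟩ y hy hty
        refine ⟨hup t ht y hy hty, ?_⟩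
        rintro rfl
        exact htx (le_antisymm hty (hx.le_of_le ht hty))
      rw [hTx, partialSubdivision_insert (Set.sdiff_subset.trans hT) (hT hxT) (by simp) hup'
        fun y hy hxy => ⟨hup x hxT y hy hxy.1, hxy.ne'⟩]
      refine (ih _ (Set.ncard_sdiff_singleton_lt_of_mem hxT hTfin) (Set.sdiff_subset.trans hT)
        hup' rfl).stellar (by simpa using nonempty_of_mem_faces (hT hxT)) ?_ (by simp)
      intro h
      have := ((mem_aug_partialSubdivision (Set.sdiff_subset.trans hT)).1 (mem_aug_of_mem h)).2.2.1
      rw [mem_aug_whitney] at this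
      simpa using this.1 x (by simp)

theorem IsVertexSphere.subdivision {G : PreAbstractSimplicialComplex α} {d : ℤ}
    (hG : IsVertexSphere d G) : IsVertexSphere d (whitney (inclusionGraph α) G.faces) := by
  have h := isVertexSphere_partialSubdivision hG subset_rfl fun _ _ y hy _ => hy
  have key := fun z => mem_aug_partialSubdivision (G := G) subset_rfl (z := z)
  convert h.comap (f := .inr) fun z hz => ⟨z.toRight, ?_⟩
  · refine ext_aug fun z => ?_
    rw [mem_aug_comap, key]
    have : ∀ t ∈ G.faces, t ≠ ∅ := fun t ht => (nonempty_of_mem_faces ht).ne_empty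
    rw [show (z.map (.inr : Finset α ↪ α ⊕ Finset α)).toLeft = ∅ by ext; simp,
      show (z.map (.inr : Finset α ↪ α ⊕ Finset α)).toRight = z by ext; simp]
    simpa [empty_mem_aug, Finset.subset_empty] using fun _ => this
  · have := (key z).1 (mem_aug_of_mem hz)
    -- When T consists of all simplices, a nonempty left part would be a member of T contained in
    -- itself, so only chains remain.
    have hz0 : z.toLeft = ∅ := by
      rcases this.1 with h | h
      · exact h
      · exact absurd subset_rfl (this.2.1 _ h)
    ext (y | y)
    · simpa [hz0] using fun h => Finset.notMem_empty y (hz0 ▸ Finset.mem_toLeft.2 h)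
    · simp

end Subdivision

/-! ### The unit spheres of a level set. -/

section LevelSets

variable {α : Type*} [DecidableEq α]

/-- The symmetric difference with `x` as a permutation of the finite sets. -/
def symmDiffEmbedding (x : Finset α) : Finset α ↪ Finset α :=
  ⟨fun y => symmDiff x y, symmDiff_right_injective x⟩

/-- Symmetric difference with x is an involution. It acts as y ↦ y \ x above x and as y ↦ x \ y
below x, so one relabelling serves both halves. -/
theorem exists_map_symmDiffEmbedding (x : Finset α) (z : Finset (Finset α)) :
    ∃ y, Finset.map (symmDiffEmbedding x) y = z := by
  refine ⟨z.map (symmDiffEmbedding x), ?_⟩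
  rw [Finset.map_map]
  convert Finset.map_refl
  ext y : 1
  exact symmDiff_symmDiff_cancel_left x y

/-- The simplices larger than `x` form a subdivision of the link of `x`. -/
theorem IsVertexSphere.whitney_above {G : PreAbstractSimplicialComplex α} {x : Finset α} {d : ℤ}
    (hx : x ∈ G.faces) (h : IsVertexSphere d (link G x)) :
    IsVertexSphere d (whitney (inclusionGraph α) {y | y ∈ G.faces ∧ x ⊂ y}) := by
  convert h.subdivision.comap (f := symmDiffEmbedding x) fun z _ => exists_map_symmDiffEmbedding x z
  refine ext_aug fun z => ?_
  rw [mem_aug_comap, mem_aug_whitney, mem_aug_whitney]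
  have key : ∀ y, symmDiff x y ∈ (link G x).faces ↔ y ∈ G.faces ∧ x ⊂ y := by
    intro y
    rw [mem_faces_iff, mem_aug_link (mem_aug_of_mem hx)]
    constructor
    · rintro ⟨h1, h2, h3⟩
      have hxy : x ⊆ y := by
        intro v hv
        by_contra hvy
        exact Finset.disjoint_left.1 h3 (Finset.mem_symmDiff.2 (Or.inl ⟨hv, hvy⟩)) hv
      refine ⟨mem_faces_iff.2 ⟨(nonempty_of_mem_faces hx).mono hxy, ?_⟩,
        Finset.ssubset_iff_subset_ne.2 ⟨hxy, ?_⟩⟩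
      · convert h2
        ext v
        simp only [Finset.mem_union, Finset.mem_symmDiff]
        have := @hxy v
        tauto
      · rintro rfl
        simp at h1
    · rintro ⟨h1, h2⟩
      have : symmDiff x y = y \ x := by
        ext v
        have := @h2.1 v
        simp only [Finset.mem_symmDiff, Finset.mem_sdiff]
        tauto
      rw [this, Finset.sdiff_union_of_subset h2.1]
      exact ⟨Finset.sdiff_nonempty.2 h2.2, mem_aug_of_mem h1, Finset.sdiff_disjoint⟩
  have key2 : ∀ y y', x ⊂ y → x ⊂ y' → (symmDiff x y ⊆ symmDiff x y' ↔ y ⊆ y') := by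
    intro y y' h h'
    have h1 := h.1
    have h2 := h'.1
    simp only [Finset.subset_iff, Finset.mem_symmDiff] at *
    grind
  simp only [Finset.forall_mem_map, symmDiffEmbedding, Function.Embedding.coeFn_mk, key]
  refine and_congr_right fun h => ?_
  refine forall₂_congr fun y hy => forall₂_congr fun y' hy' => ?_
  rw [key2 y y' (h y hy).2 (h y' hy').2, key2 y' y (h y' hy').2 (h y hy).2]

/-- The proper faces of a simplex that meet both parts of a partition of its vertices form a
sphere. -/
theorem isVertexSphere_whitney_below {A B : Finset α} (hAB : Disjoint A B) (hA : A.Nonempty)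
    (hB : B.Nonempty) :
    IsVertexSphere ((A ∪ B).card - 3) (whitney (inclusionGraph α)
      {y | y ⊂ A ∪ B ∧ (∃ v ∈ y, v ∈ A) ∧ ∃ v ∈ y, v ∈ B}) := by
  have h : IsVertexSphere ((A ∪ B).card - 3)
      (join A (simplexBoundary A) (simplexBoundary B)) := by
    convert (isVertexSphere_simplexBoundary hA).join (isVertexSphere_simplexBoundary hB)
      (V := A) ?_ ?_ using 1
    · rw [Finset.card_union_of_disjoint hAB]
      push_cast
      ring
    · intro z hz
      exact ((mem_aug_simplexBoundary hA).1 hz).1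
    · intro z hz
      exact hAB.symm.mono_left ((mem_aug_simplexBoundary hB).1 hz).1
  set x := A ∪ B with hx
  convert h.subdivision.comap (f := symmDiffEmbedding x) fun z _ => exists_map_symmDiffEmbedding x z
  refine ext_aug fun z => ?_
  rw [mem_aug_comap, mem_aug_whitney, mem_aug_whitney]
  -- A face y meets A and B exactly when its complement in x contains neither, and y is proper
  -- exactly when the complement is nonempty.
  have key : ∀ y, symmDiff x y ∈ (join A (simplexBoundary A) (simplexBoundary B)).faces ↔
      y ⊂ x ∧ (∃ v ∈ y, v ∈ A) ∧ ∃ v ∈ y, v ∈ B := by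
    intro y
    rw [mem_faces_iff, mem_aug_join, mem_aug_simplexBoundary hA, mem_aug_simplexBoundary hB]
    have hd := Finset.disjoint_left.1 hAB
    simp only [Finset.ssubset_def, Finset.not_subset]
    simp only [Finset.Nonempty, Finset.subset_iff, Finset.mem_symmDiff, Finset.mem_inter, Finset.mem_sdiff, hx, Finset.mem_union]
    constructor
    · rintro ⟨⟨u, hu⟩, ⟨h1, v, hv, hv'⟩, h2, w, hw, hw'⟩
      refine ⟨⟨fun t ht => ?_, ?_⟩, ⟨v, ?_, hv⟩, w, ?_, hw⟩ <;> grind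
    · rintro ⟨⟨h1, u, hu, hu'⟩, ⟨v, hv, hv'⟩, w, hw, hw'⟩
      refine ⟨⟨u, by grind⟩, ⟨fun t ht => ht.2, v, hv', by grind⟩, fun t ht => by grind, w, hw', ?_⟩
      grind
  have key2 : ∀ y y', y ⊂ x → y' ⊂ x → (symmDiff x y ⊆ symmDiff x y' ↔ y' ⊆ y) := by
    intro y y' h h'
    have h1 := h.1
    have h2 := h'.1
    simp only [Finset.subset_iff, Finset.mem_symmDiff] at *
    grind
  simp only [Finset.forall_mem_map, symmDiffEmbedding, Function.Embedding.coeFn_mk, key]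
  refine and_congr_right fun h => ?_
  refine forall₂_congr fun y hy => forall₂_congr fun y' hy' => ?_
  -- Complementation reverses inclusion, which does not affect comparability.
  rw [key2 y y' (h y hy).1 (h y' hy').1, key2 y' y (h y' hy').1 (h y hy).1, or_comm]

/-- A chain that extends by x splits at x, and any chain below x combines with any chain above it by
transitivity. The power set of x separates the two vertex sets. -/
theorem unitSphere_whitney {Q : Set (Finset α)} {x : Finset α} (hx : x ∈ Q) :
    unitSphere (whitney (inclusionGraph α) Q) {x} = join x.powerset
      (whitney (inclusionGraph α) {y | y ∈ Q ∧ y ⊂ x})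
      (whitney (inclusionGraph α) {y | y ∈ Q ∧ x ⊂ y}) := by
  have hxm : {x} ∈ (whitney (inclusionGraph α) Q).faces := by
    rw [mem_faces_iff, mem_aug_whitney]
    simp [hx]
  refine ext_aug fun z => ?_
  rw [mem_aug_unitSphere hxm, mem_aug_join, mem_aug_whitney, mem_aug_whitney, mem_aug_whitney]
  simp only [Finset.mem_union, Finset.mem_singleton, Finset.mem_inter, Finset.mem_sdiff,
    Finset.mem_powerset, Finset.singleton_subset_iff, Set.mem_ofPred_eq]
  constructor
  · rintro ⟨⟨h1, h2⟩, h3⟩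
    have hne : ∀ y ∈ z, y ≠ x := fun y hy h => h3 (h ▸ hy)
    refine ⟨⟨fun y hy => ⟨h1 y (Or.inl hy.1), hy.2.lt_of_ne (hne y hy.1)⟩,
      fun y hy y' hy' => h2 y (Or.inl hy.1) y' (Or.inl hy'.1)⟩,
      ⟨fun y hy => ⟨h1 y (Or.inl hy.1), ?_⟩,
      fun y hy y' hy' => h2 y (Or.inl hy.1) y' (Or.inl hy'.1)⟩⟩
    exact ((h2 y (Or.inl hy.1) x (Or.inr rfl)).resolve_left hy.2).lt_of_ne (hne y hy.1).symm
  · rintro ⟨⟨h1, h2⟩, h3, h4⟩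
    have h5 : ∀ y ∈ z, (y ∈ Q ∧ y ⊂ x) ∨ (¬ y ⊆ x ∧ y ∈ Q ∧ x ⊂ y) := by
      intro y hy
      by_cases h : y ⊆ x
      · exact Or.inl (h1 y ⟨hy, h⟩)
      · exact Or.inr ⟨h, h3 y ⟨hy, h⟩⟩
    refine ⟨⟨?_, ?_⟩, fun h => ?_⟩
    · rintro y (hy | rfl)
      · rcases h5 y hy with h | h
        · exact h.1
        · exact h.2.1
      · exact hx
    · rintro y (hy | rfl) y' (hy' | rfl)
      · rcases h5 y hy with h | h <;> rcases h5 y' hy' with h' | h'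
        · exact h2 y ⟨hy, h.2.1⟩ y' ⟨hy', h'.2.1⟩
        · exact Or.inl (h.2.1.trans h'.2.2.1)
        · exact Or.inr (h'.2.1.trans h.2.2.1)
        · exact h4 y ⟨hy, h.1⟩ y' ⟨hy', h'.1⟩
      · rcases h5 y hy with h | h
        · exact Or.inl h.2.1
        · exact Or.inr h.2.2.1
      · rcases h5 y' hy' with h | h
        · exact Or.inr h.2.1
        · exact Or.inl h.2.2.1
      · exact Or.inl subset_rfl
    · rcases h5 x h with h | h
      · exact h.2.ne rfl
      · exact h.1 subset_rfl

theorem isManifold_levelSet {R : Type*} [Ring R] [LinearOrder R] [IsStrictOrderedRing R]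
    {d : ℤ} {G : PreAbstractSimplicialComplex α} (hfin : G.faces.Finite) (hG : IsManifold d G)
    {f : α → R} {c : R} (hc : ∀ v, {v} ∈ G.faces → f v ≠ c) :
    IsManifold (d - 1) (levelSet G f c) := by
  refine isManifold_of_vertices fun x hx => ?_
  obtain ⟨hxG, hxf⟩ : x ∈ G.faces ∧ ChangesSign f c x := hx.2.1 (by simp)
  rw [levelSet, unitSphere_whitney (Q := {y | y ∈ G.faces ∧ ChangesSign f c y}) (x := x) ⟨hxG, hxf⟩]
  set A := x.filter (f · - c < 0) with hA
  set B := x.filter (0 < f · - c) with hB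
  -- Here c not being a value of f enters: no vertex of x has f - c = 0.
  have hxAB : A ∪ B = x := by
    ext v
    simp only [hA, hB, Finset.mem_union, Finset.mem_filter]
    have : v ∈ x → f v - c < 0 ∨ 0 < f v - c := fun hv =>
      (sub_ne_zero.2 (hc v (singleton_mem_of_mem_aug (mem_aug_of_mem hxG) hv))).lt_or_gt
    tauto
  have hdisj : Disjoint A B :=
    Finset.disjoint_filter.2 fun v _ h h' => (h.trans h').false
  have hAn : A.Nonempty := by
    obtain ⟨v, hv, h⟩ := hxf.1
    exact ⟨v, Finset.mem_filter.2 ⟨hv, h⟩⟩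
  have hBn : B.Nonempty := by
    obtain ⟨v, hv, h⟩ := hxf.2
    exact ⟨v, Finset.mem_filter.2 ⟨hv, h⟩⟩
  have hbelow := isVertexSphere_whitney_below hdisj hAn hBn
  have habove := (isVertexSphere_link (fun v hv =>
    (hG _ hv).isVertexSphere (unitSphere_finite hfin)) hxG).whitney_above hxG
  rw [hxAB] at hbelow
  have e1 : {y | y ∈ {y | y ∈ G.faces ∧ ChangesSign f c y} ∧ y ⊂ x} =
      {y | y ⊂ x ∧ (∃ v ∈ y, v ∈ A) ∧ ∃ v ∈ y, v ∈ B} := by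
    ext y
    simp only [Set.mem_ofPred_eq, ChangesSign, hA, hB, Finset.mem_filter]
    constructor
    · rintro ⟨⟨-, ⟨v, hv, h⟩, w, hw, h'⟩, hy⟩
      exact ⟨hy, ⟨v, hv, hy.1 hv, h⟩, w, hw, hy.1 hw, h'⟩
    · rintro ⟨hy, ⟨v, hv, -, h⟩, w, hw, -, h'⟩
      exact ⟨⟨(G.isRelLowerSet_faces hxG).2 hy.1 ⟨v, hv⟩, ⟨v, hv, h⟩, w, hw, h'⟩, hy⟩
  -- A sign change on x persists on every larger simplex, so above x the level set sees all of `G`.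
  have e2 : {y | y ∈ {y | y ∈ G.faces ∧ ChangesSign f c y} ∧ x ⊂ y} =
      {y | y ∈ G.faces ∧ x ⊂ y} := by
    ext y
    simp only [Set.mem_ofPred_eq]
    refine ⟨fun h => ⟨h.1.1, h.2⟩, fun h => ⟨⟨h.1, ?_⟩, h.2⟩⟩
    obtain ⟨⟨v, hv, h1⟩, w, hw, h2⟩ := hxf
    exact ⟨⟨v, h.2.1 hv, h1⟩, w, h.2.1 hw, h2⟩
  rw [e1, e2]
  convert hbelow.join habove (V := x.powerset) ?_ ?_ using 1
  · ring
  · intro z hz y hy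
    exact Finset.mem_powerset.2 ((mem_aug_whitney.1 hz).1 y hy).1.1
  · intro z hz
    refine Finset.disjoint_left.2 fun y hy hy' => ?_
    exact ((mem_aug_whitney.1 hz).1 y hy).2.2 (Finset.mem_powerset.1 hy')

theorem levelSet_le_barycentric {α R : Type*} [Ring R] [LinearOrder R]
    (G : PreAbstractSimplicialComplex α) (f : α → R) (c : R) :
    levelSet G f c ≤ barycentric G :=
  fun _ hz => ⟨hz.1, fun _ hy => (hz.2.1 hy).1, hz.2.2⟩

end LevelSets

end DiscreteSard

theorem mainTheorem9 {α R : Type*} [Ring R] [LinearOrder R] [IsStrictOrderedRing R]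
    (d : ℤ) (G : PreAbstractSimplicialComplex α) (hfin : G.faces.Finite)
    (hG : DiscreteSard.IsManifold d G)
    (f : α → R) (hf : DiscreteSard.LocallyInjective G f)
    (c : R) (hc : ∀ v : α, {v} ∈ G.faces → f v ≠ c) :
    DiscreteSard.levelSet G f c ≤ DiscreteSard.barycentric G ∧
      DiscreteSard.IsManifold (d - 1) (DiscreteSard.levelSet G f c) := by
  classical
  exact ⟨DiscreteSard.levelSet_le_barycentric G f c, DiscreteSard.isManifold_levelSet hfin hG hc⟩
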